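/- A directed hypergraph $\mathcal H$ on a finite vertex set $V$ is a family of hyperedges $H\subseteq V$, each split into two disjoint parts, its tail and its head (the same vertex set may carry several hyperedges with different splittings). It is $k$-uniform if every hyperedge has exactly $k$ vertices, and it is a $2\to1$ hypergraph if every hyperedge has exactly two tail-vertices and exactly one head-vertex; a hyperedge with tail $\{a,b\}$ and head $\{c\}$ is written $ab\to c$. We say that $\mathcal H$ has Property S if every hyperedge has fewer head-vertices than tail-vertices and, whenever two hyperedges $H_1,H_2$ satisfy $H_1\cap H_2=\{v\}$, the vertex $v$ is a head-vertex of at least one of $H_1,H_2$. (For $2\to1$ hypergraphs the first condition holds automatically.) A proper $2$-coloring of $\mathcal H$ is a coloring of $V$ with two colors such that every hyperedge contains vertices of both colors. Let $\mathcal S$ be the $2\to1$ hypergraph with vertex set $\{1,2,3,4,5\}$ and hyperedges $12\to3$ and $14\to5$; $\mathcal H$ avoids $\mathcal S$ if no (not necessarily induced) subhypergraph of $\mathcal H$ is isomorphic to $\mathcal S$. **Theorem.** (i) Every $2\to1$ hypergraph with Property S admits a proper $2$-coloring. (ii) A $2\to1$ hypergraph has Property S if and only if it avoids $\mathcal S$.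 Hence every $2\to1$ hypergraph avoiding $\mathcal S$ admits a proper $2$-coloring. (iii) Every $3$-uniform directed hypergraph with Property S admits a proper $2$-coloring. -/

import Mathlib

/-- A directed hyperedge on `V`: a finite vertex set split into a tail and a head
(either part may be empty). -/
@[ext]
structure DirectedHyperedge (V : Type*) where
  tail : Finset V
  head : Finset V
  disjoint_tail_head : Disjoint tail head

namespace DirectedHyperedge

/-- The vertex set of a directed hyperedge. -/
def verts {V : Type*} (e : DirectedHyperedge V) : Finset V :=
  e.tail.disjUnion e.head e.disjoint_tail_head

/-- The image of a directed hyperedge under an injective map of the vertices. -/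
def map {W V : Type*} (f : W ↪ V) (e : DirectedHyperedge W) : DirectedHyperedge V where
  tail := e.tail.map f
  head := e.head.map f
  disjoint_tail_head := (Finset.disjoint_map f).2 e.disjoint_tail_head

end DirectedHyperedge

/-- A directed hypergraph with vertex set `V`. The same vertex set may carry several hyperedges,
with different splittings into tail and head. -/
structure DirectedHypergraph (V : Type*) where
  edges : Set (DirectedHyperedge V)

namespace DirectedHypergraph

/-- Every hyperedge has exactly `k` vertices. -/
def IsUniform {V : Type*} (H : DirectedHypergraph V) (k : ℕ) : Prop :=
  ∀ e ∈ H.edges, e.verts.card = k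

/-- A `2 → 1` hypergraph: every hyperedge has two tail-vertices and one head-vertex. -/
def IsTwoToOne {V : Type*} (H : DirectedHypergraph V) : Prop :=
  ∀ e ∈ H.edges, e.tail.card = 2 ∧ e.head.card = 1

/-- Property S: every hyperedge has fewer head-vertices than tail-vertices, and whenever two
hyperedges meet in exactly one vertex, that vertex is a head-vertex of at least one of them. -/
def PropertyS {V : Type*} [DecidableEq V] (H : DirectedHypergraph V) : Prop :=
  (∀ e ∈ H.edges, e.head.card < e.tail.card) ∧
  ∀ e₁ ∈ H.edges, ∀ e₂ ∈ H.edges, e₁ ≠ e₂ →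
    ∀ v : V, e₁.verts ∩ e₂.verts = {v} → v ∈ e₁.head ∨ v ∈ e₂.head

/-- A proper coloring: every hyperedge contains two vertices of different colors. -/
def IsProperColoring {V C : Type*} (H : DirectedHypergraph V) (c : V → C) : Prop :=
  ∀ e ∈ H.edges, ∃ x ∈ e.verts, ∃ y ∈ e.verts, c x ≠ c y

/-- `H` admits a proper `2`-coloring. -/
def ProperlyTwoColorable {V : Type*} (H : DirectedHypergraph V) : Prop :=
  ∃ c : V → Fin 2, H.IsProperColoring c

/-- `H` avoids `F`: no (not necessarily induced) subhypergraph of `H` is a copy of `F`. -/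
def Avoids {V W : Type*} (H : DirectedHypergraph V) (F : DirectedHypergraph W) : Prop :=
  ¬ ∃ f : W ↪ V, ∀ e ∈ F.edges, e.map f ∈ H.edges

/-- The `2 → 1` hypergraph with five vertices and hyperedges `12 → 3` and `14 → 5`; the vertices
`1, 2, 3, 4, 5` are represented by `0, 1, 2, 3, 4`. -/
def forbiddenPair : DirectedHypergraph (Fin 5) where
  edges := {⟨{0, 1}, {2}, by decide⟩, ⟨{0, 3}, {4}, by decide⟩}

end DirectedHypergraph

/-! Part (iii) carries (i); part (ii) is a direct check. From each triple keep two tail-vertices. By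
Property S the pairs completing a vertex `v` to a triple with `v` as kept tail intersect pairwise,
so they form a star with a center or a triangle (`exists_center`). It suffices to find a forest in
which every triple contains a vertex together with its parent: coloring by parity of depth is then
proper. The parent of `v` is to be its center, or a vertex of its triangle. Roots are chosen one in
each minimal set closed under these arcs, and vertices are added one by one. If the forest stops
growing, the vertices left out form a closed set, which contains a root: a contradiction
(`exists_growth_univ`). A vertex with a center is attached to it as a leaf. The hard case is a
vertex with a triangle (`insert_of_isTri`), which may have to be spliced into an existing edge. -/

/-- `L v x y` says that `{v, x, y}` is a triple of a family in which every triple has exactly two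
tail-vertices, and that `v` is one of them; two triples with a common tail-vertex share a second
vertex. -/
structure IsTailLink {V : Type*} (L : V → V → V → Prop) : Prop where
  symm : ∀ {v x y}, L v x y → L v y x
  ne : ∀ {v x y}, L v x y → v ≠ x ∧ v ≠ y ∧ x ≠ y
  other : ∀ {v x y}, L v x y → L x v y ∨ L y v x
  not_both : ∀ {v x y}, L v x y → L x v y → ¬ L y v x
  meet : ∀ {v x y z w}, L v x y → L v z w → x = z ∨ x = w ∨ y = z ∨ y = w

namespace IsTailLink

/-! ### Links of a vertex: a star or a triangle -/

variable {V : Type*} {L : V → V → V → Prop}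

/-- The links of `v` are the three pairs in `{x, y, z}`. -/
def Tri (L : V → V → V → Prop) (v x y z : V) : Prop := L v x y ∧ L v y z ∧ L v x z

/-- The links of `v` form a triangle. -/
def IsTri (L : V → V → V → Prop) (v : V) : Prop := ∃ x y z, Tri L v x y z

/-- A center of the links of every vertex whose links do not form a triangle. -/
def IsCenter (L : V → V → V → Prop) (ctr : V → V) : Prop :=
  ∀ {v x y}, ¬ IsTri L v → L v x y → ctr v = x ∨ ctr v = y

/-- The dependency digraph: from `v` to the center of its links, or to the three vertices of the
triangle formed by them. -/
def Arc (L : V → V → V → Prop) (ctr : V → V) (v w : V) : Prop :=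
  (IsTri L v ∧ ∃ z, L v w z) ∨ (¬ IsTri L v ∧ w = ctr v)

theorem exists_center (h : IsTailLink L) : ∃ ctr : V → V, IsCenter L ctr := by
  have key : ∀ v, ∃ c, ¬ IsTri L v → ∀ x y, L v x y → c = x ∨ c = y := by
    intro v
    by_contra hc
    push Not at hc
    -- The candidate `v` only serves to get a link; `x` and `y` as failed centers give links
    -- avoiding each, and the three links form a triangle.
    obtain ⟨hv, x, y, hxy, -⟩ := hc v
    obtain ⟨-, z, w, hzw, h1, h2⟩ := hc x
    obtain ⟨-, z', w', hzw', h1', h2'⟩ := hc y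
    apply hv
    have a1 := h.meet hxy hzw
    have a2 := h.meet hxy hzw'
    have a3 := h.meet hzw hzw'
    have n1 := h.ne hxy
    have s1 := h.symm hzw
    have s2 := h.symm hzw'
    obtain ⟨u, hu⟩ : ∃ u, L v y u ∧ u ≠ x := by grind
    obtain ⟨u', hu'⟩ : ∃ u, L v x u ∧ u ≠ y := by grind
    have := h.meet hu.1 hu'.1
    have e : u = u' := by grind
    subst e
    exact ⟨x, y, u, hxy, hu.1, hu'.1⟩
  choose ctr hctr using key
  exact ⟨ctr, fun hv hxy => hctr _ hv _ _ hxy⟩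

theorem Tri.mem (h : IsTailLink L) {v x y z p q : V} (ht : Tri L v x y z) (hp : L v p q) :
    (p = x ∨ p = y ∨ p = z) ∧ (q = x ∨ q = y ∨ q = z) := by
  obtain ⟨h1, h2, h3⟩ := ht
  have a1 := h.meet h1 hp
  have a2 := h.meet h2 hp
  have a3 := h.meet h3 hp
  have := h.ne hp
  have := h.ne h1
  have := h.ne h2
  have := h.ne h3
  grind

theorem Tri.swap (h : IsTailLink L) {v x y z : V} (ht : Tri L v x y z) : Tri L v y x z :=
  ⟨h.symm ht.1, ht.2.2, ht.2.1⟩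

theorem Tri.rotate (h : IsTailLink L) {v x y z : V} (ht : Tri L v x y z) : Tri L v y z x :=
  ⟨ht.2.1, h.symm ht.2.2, h.symm ht.1⟩

theorem exists_tri_of_isTri (h : IsTailLink L) {v x y : V} (hv : IsTri L v) (hxy : L v x y) :
    ∃ z, Tri L v x y z := by
  obtain ⟨a, b, c, ht⟩ := hv
  have := ht.mem h hxy
  have := h.ne hxy
  have t1 := ht.rotate h
  have t2 := t1.rotate h
  have := ht.swap h
  have := t1.swap h
  have := t2.swap h
  grind

/-! ### Partial forests and the two ways to add a vertex -/

/-- A partial forest `p` on `U` with roots `R`, following the arcs, such that each triple with both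
tail-vertices in `U` contains a vertex of `U` that is not a root, together with its parent. -/
structure Growth (L : V → V → V → Prop) (ctr : V → V) (R U : Set V) (p : V → V) (ρ : V → ℕ) :
    Prop where
  root_mem : ∀ {r}, r ∈ R → r ∈ U
  root_rank : ∀ {r}, r ∈ R → ρ r = 0
  map_mem : ∀ {v}, v ∈ U → v ∉ R → p v ∈ U
  rank_lt : ∀ {v}, v ∈ U → v ∉ R → ρ (p v) < ρ v
  arc : ∀ {v}, v ∈ U → v ∉ R → Arc L ctr v (p v)
  cover : ∀ {v x y}, v ∈ U → x ∈ U → L v x y → L x v y →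
    (v ∉ R ∧ (p v = x ∨ p v = y)) ∨ (x ∉ R ∧ (p x = v ∨ p x = y))

variable {ctr : V → V} {R U : Set V} {p : V → V} {ρ : V → ℕ}

open Classical in
theorem Growth.insert_leaf (h : IsTailLink L) (g : Growth L ctr R U p ρ) {a u : V} (ha : a ∉ U)
    (hu : u ∈ U) (harc : Arc L ctr a u)
    (hc : ∀ x y, x ∈ U → L a x y → L x a y → ¬ (x ∉ R ∧ (p x = a ∨ p x = y)) → u = x ∨ u = y) :
    ∃ p' ρ', Growth L ctr R (insert a U) p' ρ' := by
  have haR : a ∉ R := fun h => ha (g.root_mem h)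
  refine ⟨Function.update p a u, Function.update ρ a (ρ u + 1), ?_, ?_, ?_, ?_, ?_, ?_⟩
  · exact fun hr => Or.inr (g.root_mem hr)
  · intro r hr
    have := g.root_rank hr
    grind
  · intro v hv hvR
    have := @g.map_mem v
    grind
  · intro v hv hvR
    have := @g.map_mem v
    have := @g.rank_lt v
    grind
  · intro v hv hvR
    have := @g.arc v
    grind
  · intro v x y hv hx hvx hxv
    have := @g.cover v x y
    have := h.ne hvx
    have := hc v y
    have := hc x y
    grind

open Classical in
-- Reroutes `t` through `a`, as `t → a → q`. Triples of `t` containing `a` become covered by `t`;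
-- those without `a` may lose their cover at `t`, so `hct` asks for a cover at the other
-- tail-vertex.
theorem Growth.insert_between (h : IsTailLink L) (g : Growth L ctr R U p ρ) {a t q : V} (ha : a ∉ U)
    (ht : t ∈ U) (htR : t ∉ R) (hq : q ∈ U) (hqt : ρ q < ρ t)
    (haq : Arc L ctr a q) (hta : Arc L ctr t a)
    (hca : ∀ x y, x ∈ U → L a x y → L x a y → q = x ∨ q = y ∨ x = t)
    (hct : ∀ x y, x ∈ U → x ≠ a → y ≠ a → L t x y → L x t y → x ∉ R ∧ (p x = t ∨ p x = y)) :
    ∃ p' ρ', Growth L ctr R (insert a U) p' ρ' := by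
  have haR : a ∉ R := fun h => ha (g.root_mem h)
  have hat : a ≠ t := fun h => ha (h ▸ ht)
  obtain ⟨p', hp1, hp2, hp3⟩ : ∃ p' : V → V, p' t = a ∧ p' a = q ∧
      ∀ w, w ≠ a → w ≠ t → p' w = p w :=
    ⟨Function.update (Function.update p a q) t a, by simp, by simp [hat],
      fun w h1 h2 => by simp [h1, h2]⟩
  -- Doubling the ranks makes room for `a` strictly between `q` and `t`.
  obtain ⟨ρ', hr1, hr2⟩ : ∃ ρ' : V → ℕ, ρ' a = 2 * ρ q + 1 ∧ ∀ w, w ≠ a → ρ' w = 2 * ρ w :=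
    ⟨Function.update (fun v => 2 * ρ v) a (2 * ρ q + 1), by simp, fun w h1 => by simp [h1]⟩
  have hU : ∀ {w}, w ∈ U → w ≠ a := fun hw e => ha (e ▸ hw)
  refine ⟨p', ρ', ?_, ?_, ?_, ?_, ?_, ?_⟩
  · exact fun hr => Or.inr (g.root_mem hr)
  · intro r hr
    rw [hr2 r (hU (g.root_mem hr)), g.root_rank hr]
  · rintro v (rfl | hv) hvR
    · exact Or.inr (hp2 ▸ hq)
    · by_cases hvt : v = t
      · exact Or.inl (hvt ▸ hp1)
      · exact Or.inr (hp3 v (hU hv) hvt ▸ g.map_mem hv hvR)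
  · rintro v (rfl | hv) hvR
    · rw [hp2, hr1, hr2 q (hU hq)]
      omega
    · by_cases hvt : v = t
      · rw [hvt, hp1, hr1, hr2 t (hU ht)]
        omega
      · rw [hp3 v (hU hv) hvt, hr2 v (hU hv), hr2 _ (hU (g.map_mem hv hvR))]
        have := g.rank_lt hv hvR
        omega
  · rintro v (rfl | hv) hvR
    · exact hp2 ▸ haq
    · by_cases hvt : v = t
      · rw [hvt, hp1]
        exact hta
      · rw [hp3 v (hU hv) hvt]
        exact g.arc hv hvR
  · intro v x y hv hx hvx hxv
    have hne := h.ne hvx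
    rcases hv with rfl | hv
    · rcases hx with rfl | hx
      · exact absurd rfl hne.1
      · have := hca x y hx hvx hxv
        grind
    rcases hx with rfl | hx
    · have := hca v y hv hxv hvx
      grind
    have k := g.cover hv hx hvx hxv
    have hva := hU hv
    have hxa := hU hx
    have := hp3 v hva
    have := hp3 x hxa
    by_cases hvt : v = t
    · by_cases hya : y = a
      · grind
      · have := hct x y hx hxa hya (hvt ▸ hvx) (hvt ▸ hxv)
        grind
    · by_cases hxt : x = t
      · by_cases hya : y = a
        · grind
        · have := hct v y hv hva hya (hxt ▸ hxv) (hxt ▸ hvx)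
          grind
      · grind

theorem Growth.parent_eq_center (g : Growth L ctr R U p ρ) {v : V} (hv : v ∈ U) (hR : v ∉ R)
    (ht : ¬ IsTri L v) : p v = ctr v := by
  rcases g.arc hv hR with h | h
  · exact absurd h.1 ht
  · exact h.2

theorem Tri.isTri {v x y z : V} (ht : Tri L v x y z) : IsTri L v := ⟨x, y, z, ht⟩

theorem Growth.parent_mem (h : IsTailLink L) (g : Growth L ctr R U p ρ) {v x y z : V} (hv : v ∈ U)
    (hR : v ∉ R) (ht : Tri L v x y z) : p v = x ∨ p v = y ∨ p v = z := by
  rcases g.arc hv hR with ⟨-, w, hw⟩ | h'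
  · exact (ht.mem h hw).1
  · exact absurd ht.isTri h'.1

/-- A vertex whose parent is outside of one of its triples has a triangle of links, and its parent
is the third vertex of it. -/
theorem Growth.tri_of_not_cover (h : IsTailLink L) (hctr : IsCenter L ctr)
    (g : Growth L ctr R U p ρ) {v x y : V} (hv : v ∈ U) (hR : v ∉ R) (hxy : L v x y)
    (hc : ¬ (p v = x ∨ p v = y)) : Tri L v x y (p v) := by
  by_cases ht : IsTri L v
  · obtain ⟨z, hz⟩ := h.exists_tri_of_isTri ht hxy
    have := g.parent_mem h hv hR hz
    grind
  · have := g.parent_eq_center hv hR ht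
    have := hctr ht hxy
    grind

theorem eq_of_tri (h : IsTailLink L) {v x y z : V} (hv : IsTri L v) (hxy : L v x y)
    (hxz : L v x z) (hne : y ≠ z) : Tri L v x y z := by
  obtain ⟨w, hw⟩ := h.exists_tri_of_isTri hv hxy
  have := hw.mem h hxz
  have := h.ne hxz
  grind

theorem center_eq (hctr : IsCenter L ctr) {v x y z : V} (hv : ¬ IsTri L v)
    (hxy : L v x y) (hxz : L v x z) (hne : y ≠ z) : ctr v = x := by
  have := hctr hv hxy
  have := hctr hv hxz
  grind

theorem arc_of_link {v x y : V} (hv : IsTri L v) (hxy : L v x y) : Arc L ctr v x :=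
  Or.inl ⟨hv, y, hxy⟩

/-! ### Adding a vertex whose links form a triangle -/

/-- The triple `{a, x, y}` has the tail-vertices `a` and `x`, and `x` is a vertex of `U` that is a
root or has its parent outside of the triple. -/
def Uncovered (L : V → V → V → Prop) (R U : Set V) (p : V → V) (a x y : V) : Prop :=
  x ∈ U ∧ L a x y ∧ L x a y ∧ ¬ (x ∉ R ∧ (p x = a ∨ p x = y))

/-- The center of a root with a center is in `U`, is not a root and has a center itself. -/
def CenteredRoots (L : V → V → V → Prop) (ctr : V → V) (R U : Set V) : Prop :=
  ∀ {r x y}, r ∈ R → ¬ IsTri L r → L r x y → ctr r ∈ U ∧ ¬ IsTri L (ctr r) ∧ ctr r ∉ R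

/-- Every root with a triangle of links lies in a set closed under the arcs with no other root. -/
def SeparatedRoots (L : V → V → V → Prop) (ctr : V → V) (R : Set V) : Prop :=
  ∀ {r}, r ∈ R → IsTri L r → ∃ C : Set V, r ∈ C ∧ (∀ v ∈ C, ∀ w, Arc L ctr v w → w ∈ C) ∧
    ∀ w ∈ C, w ∈ R → w = r

theorem Uncovered.tri (h : IsTailLink L) (hctr : IsCenter L ctr) (g : Growth L ctr R U p ρ)
    {a x y : V} (hx : Uncovered L R U p a x y) (hR : x ∉ R) : Tri L x a y (p x) :=
  g.tri_of_not_cover h hctr hx.1 hR hx.2.2.1 (fun hc => hx.2.2.2 ⟨hR, hc⟩)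

theorem Growth.insert_of_two (h : IsTailLink L) (hctr : IsCenter L ctr)
    (g : Growth L ctr R U p ρ) (h1 : CenteredRoots L ctr R U) {a s t t' : V} (ha : a ∉ U)
    (htri : Tri L a s t t') (hs : s ∉ U) (ht : Uncovered L R U p a t s)
    (ht' : Uncovered L R U p a t' s) (htt : L t a t') (hn : ¬ Uncovered L R U p a t t') :
    ∃ p' ρ', Growth L ctr R (insert a U) p' ρ' := by
  have hcov : t ∉ R ∧ (p t = a ∨ p t = t') := by
    by_contra hc
    exact hn ⟨ht.1, htri.2.1, htt, hc⟩
  have htU := ht.1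
  have ht'U := ht'.1
  have hptU := g.map_mem htU hcov.1
  have hpt : p t = t' := by grind
  have ttri := ht.tri h hctr g hcov.1
  rw [hpt] at ttri
  have n1 := h.ne htri.1
  have n2 := h.ne htri.2.1
  have n3 := h.ne htri.2.2
  refine g.insert_between h ha htU hcov.1 ht'U (hpt ▸ g.rank_lt htU hcov.1)
    (arc_of_link htri.isTri (h.symm htri.2.1)) (arc_of_link ttri.isTri ttri.1) ?_ ?_
  · intro x y hx hxy _
    have := htri.mem h hxy
    have := h.ne hxy
    grind
  · intro x y hx hxa hya hxy hyx
    -- The only triple of `t` without `a` is `{t, t', s}`, and `s ∉ U`, so its other tail-vertex in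
    -- `U` would be `t'`. Then `t'` has either a link `{a, t}`, giving three tails to a triple, or
    -- the center `s` outside of `U`.
    exfalso
    have := ttri.mem h hxy
    have := h.ne hxy
    have e1 : x = t' := by grind
    have e2 : y = s := by grind
    subst e1 e2
    by_cases hT : IsTri L x
    · have := h.eq_of_tri hT (h.symm ht'.2.2.1) (h.symm hyx) n2.1
      exact h.not_both htri.2.1 htt this.2.1
    · have hc := center_eq hctr hT (h.symm ht'.2.2.1) (h.symm hyx) n2.1
      by_cases hR : x ∈ R
      · have := h1 hR hT hyx
        grind
      · have := g.parent_eq_center hx hR hT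
        have := g.map_mem hx hR
        grind

/-- A vertex `t` leaving two triples of `a` uncovered must be a root with a triangle, hence the only
root of its closed set. The new vertex goes between `x` and `t`, and it remains to cover the triple
`{x, y, p x}`. -/
theorem Growth.insert_of_repeated (h : IsTailLink L) (hctr : IsCenter L ctr)
    (g : Growth L ctr R U p ρ) (h1 : CenteredRoots L ctr R U) (h2 : SeparatedRoots L ctr R)
    {a t x y : V} (ha : a ∉ U) (htx : Uncovered L R U p a t x) (hty : Uncovered L R U p a t y)
    (hxy : Uncovered L R U p a x y) :
    ∃ p' ρ', Growth L ctr R (insert a U) p' ρ' := by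
  obtain ⟨htU, atx, tax, ctx⟩ := htx
  obtain ⟨-, aty, tay, cty⟩ := hty
  obtain ⟨hxU, axy, xay, cxy⟩ := hxy
  have n1 := h.ne atx
  have n2 := h.ne aty
  have n3 := h.ne axy
  have atri : Tri L a t x y := ⟨atx, axy, aty⟩
  have htR : t ∈ R := by
    by_contra hR
    have k := g.tri_of_not_cover h hctr htU hR tax (fun hc => ctx ⟨hR, hc⟩)
    have := k.mem h tay
    grind
  have hT : IsTri L t := by
    by_contra hT
    have := center_eq hctr hT tax tay n3.2.2
    have := h1 htR hT tax
    grind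
  have ttri : Tri L t a x y := h.eq_of_tri hT tax tay n3.2.2
  obtain ⟨C, htC, hC, hCR⟩ := h2 htR hT
  have hxC : x ∈ C := hC t htC x (arc_of_link hT (h.symm tax))
  have hyC : y ∈ C := hC t htC y (arc_of_link hT (h.symm tay))
  have hxR : x ∉ R := fun hR => n1.2.2 (hCR x hxC hR).symm
  have xtri := g.tri_of_not_cover h hctr hxU hxR xay (fun hc => cxy ⟨hxR, hc⟩)
  have hwU := g.map_mem hxU hxR
  have hwx := g.rank_lt hxU hxR
  obtain ⟨w, hw⟩ : ∃ w, p x = w := ⟨_, rfl⟩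
  rw [hw] at xtri hwU hwx
  have hwC : w ∈ C := hC x hxC w (arc_of_link xtri.isTri (h.symm xtri.2.2))
  have n4 := h.ne xtri.2.2
  have n5 := h.ne xtri.2.1
  have hwt : w ≠ t := by
    rintro rfl
    exact h.not_both atx tax xtri.2.2
  have hwR : w ∉ R := fun hR => hwt (hCR w hwC hR)
  have wxa : L w x a := by
    rcases h.other xtri.2.2 with k | k
    · have := atri.mem h k
      grind
    · exact k
  refine g.insert_between h ha hxU hxR htU ?_ (arc_of_link atri.isTri atx)
    (arc_of_link xtri.isTri xay) ?_ ?_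
  · have := g.root_rank htR
    omega
  · intro x' y' hx' hxy' hyx'
    have := atri.mem h hxy'
    have := h.ne hxy'
    have := h.not_both axy xay
    grind
  · intro x' y' hx' hxa' hya' hxy' hyx'
    have m := xtri.mem h hxy'
    have n := h.ne hxy'
    have hcase : (x' = w ∧ y' = y) ∨ (x' = y ∧ y' = w) := by grind
    rcases hcase with ⟨rfl, rfl⟩ | ⟨rfl, rfl⟩
    · refine ⟨hwR, ?_⟩
      have hlt := g.rank_lt hwU hwR
      have hpx : p x' ≠ x := by
        intro e
        rw [e] at hlt
        omega
      by_cases hT' : IsTri L x'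
      · have k := h.eq_of_tri hT' wxa hyx' n3.2.1
        have := g.parent_mem h hwU hwR k
        have := g.map_mem hwU hwR
        grind
      · exact Or.inl ((g.parent_eq_center hwU hwR hT').trans (center_eq hctr hT' wxa hyx' n3.2.1))
    · have hyR : x' ∉ R := fun hR => n2.2.2 (hCR x' hyC hR).symm
      refine ⟨hyR, ?_⟩
      -- If `y` does not cover the triple either, the parent `z` of `y` leads to a 2-cycle of
      -- parents, `x` with `w` or `y` with `z`, or to a triple with a single tail-vertex.
      by_contra hcy
      have ytri := g.tri_of_not_cover h hctr hx' hyR hyx' hcy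
      have hzU := g.map_mem hx' hyR
      have hzy := g.rank_lt hx' hyR
      obtain ⟨z, hz⟩ : ∃ z, p x' = z := ⟨_, rfl⟩
      rw [hz] at ytri hzU hzy
      have n6 := h.ne ytri.2.2
      have n7 := h.ne ytri.2.1
      have hza : z ≠ a := by grind
      have zyx : L z x' x := by
        rcases h.other ytri.2.2 with k | k
        · have := xtri.mem h k
          grind
        · exact k
      have zyw : L z x' y' := by
        rcases h.other ytri.2.1 with k | k
        · have := h.meet wxa k
          grind
        · exact k
      have hzR : z ∉ R := by
        intro hR
        have e := hCR z (hC _ hyC z (arc_of_link ytri.isTri (h.symm ytri.2.2))) hR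
        subst e
        have := ttri.mem h zyw
        grind
      by_cases hTz : IsTri L z
      · have ztri := h.eq_of_tri hTz zyx zyw n4.2.1
        have wzx : L y' x z := by
          rcases h.other ztri.2.1 with k | k
          · have := xtri.mem h k
            grind
          · exact h.symm k
        by_cases hTw : IsTri L y'
        · have wtri := h.eq_of_tri hTw wxa wzx hza.symm
          rcases h.other wtri.2.1 with k | k
          · have := atri.mem h k
            grind
          · have := ztri.mem h k
            grind
        · have e := (g.parent_eq_center hwU hwR hTw).trans
            (center_eq hctr hTw wxa wzx hza.symm)
          have := g.rank_lt hwU hwR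
          rw [e] at this
          omega
      · have e := (g.parent_eq_center hzU hzR hTz).trans
          (center_eq hctr hTz zyx zyw n4.2.1)
        have := g.rank_lt hzU hzR
        rw [e] at this
        omega

/-- The parent `y` of `c` has the links `{c, a}` and `{c, x}`. If its center is `c`, then `y` and
`c` are parents of each other, or `y` is a root whose center has a triangle. If it has a triangle,
`y` is also the parent of `x`, and `{x, v, y}` has no second tail-vertex. -/
theorem Growth.not_cyclic_of_not_root (h : IsTailLink L) (hctr : IsCenter L ctr)
    (g : Growth L ctr R U p ρ) (h1 : CenteredRoots L ctr R U) {a v c x : V}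
    (hv : Uncovered L R U p a v c) (hc : Uncovered L R U p a c x) (hx : Uncovered L R U p a x v)
    (hvT : IsTri L v) (hcR : c ∉ R) (hxR : x ∉ R) : False := by
  have ctri := hc.tri h hctr g hcR
  have xtri := hx.tri h hctr g hxR
  obtain ⟨b, vtri⟩ := h.exists_tri_of_isTri hvT hv.2.2.1
  have hyU := g.map_mem hc.1 hcR
  have hyc := g.rank_lt hc.1 hcR
  generalize hpc : p c = y at ctri hyU hyc
  generalize p x = z at xtri
  obtain ⟨-, avc, vac, -⟩ := hv
  obtain ⟨-, acx, cax, -⟩ := hc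
  obtain ⟨-, axv, xav, -⟩ := hx
  have n1 := h.ne avc
  have n2 := h.ne acx
  have n3 := h.ne axv
  have nb1 := h.not_both avc vac
  have nb2 := h.not_both acx cax
  have nb3 := h.not_both axv xav
  have atri : Tri L a v c x := ⟨avc, acx, h.symm axv⟩
  have n4 := h.ne ctri.2.1
  have n5 := h.ne ctri.2.2
  have n6 := h.ne xtri.2.1
  have n7 := h.ne vtri.2.1
  have hyv : y ≠ v := by
    rintro rfl
    exact nb1 ctri.2.2
  have hzc : z ≠ c := by
    rintro rfl
    exact nb2 xtri.2.2
  have hbx : b ≠ x := by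
    rintro rfl
    exact nb3 vtri.2.2
  have yca : L y c a := by
    rcases h.other ctri.2.2 with k | k
    · have := atri.mem h k
      grind
    · exact k
  have ycx : L y c x := by
    rcases h.other ctri.2.1 with k | k
    · have := xtri.mem h k
      grind
    · exact k
  by_cases hT : IsTri L y
  · have ytri := h.eq_of_tri hT yca ycx n3.1
    have xya : L x y a := by
      rcases h.other ytri.2.1 with k | k
      · have := atri.mem h k
        grind
      · exact k
    have hyz : y = z := by
      have := xtri.mem h xya
      grind
    subst hyz
    rcases h.other xtri.2.1 with k | k
    · have := vtri.mem h k
      grind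
    · have := ytri.mem h k
      grind
  · have e := center_eq hctr hT yca ycx n3.1
    by_cases hR : y ∈ R
    · exact (h1 hR hT yca).2.1 (e ▸ ctri.isTri)
    · have := g.rank_lt hyU hR
      rw [g.parent_eq_center hyU hR hT, e] at this
      omega

/-- At most one vertex of the cycle is a root, so a rotation reduces to the case where `c` and `x`
are not roots. -/
theorem Uncovered.isTri_and_not_root (h : IsTailLink L) (hctr : IsCenter L ctr)
    (g : Growth L ctr R U p ρ) (h1 : CenteredRoots L ctr R U) (h2 : SeparatedRoots L ctr R)
    {a v c x : V} (ha : a ∉ U)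
    (hv : Uncovered L R U p a v c) (hc : Uncovered L R U p a c x) (hx : Uncovered L R U p a x v) :
    IsTri L v ∧ (v ∈ R → c ∉ R ∧ x ∉ R) := by
  by_cases hR : v ∈ R
  · have hT : IsTri L v := by
      by_contra hT
      have k := h1 hR hT hv.2.2.1
      have := hctr hT hv.2.2.1
      have e : ctr v = c := by grind
      rw [e] at k
      exact k.2.1 (hc.tri h hctr g k.2.2).isTri
    refine ⟨hT, fun _ => ?_⟩
    obtain ⟨C, hvC, hC, hCR⟩ := h2 hR hT
    have haC : a ∈ C := hC v hvC a (arc_of_link hT hv.2.2.1)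
    have haT : IsTri L a := ⟨v, c, x, hv.2.1, hc.2.1, h.symm hx.2.1⟩
    have n1 := h.ne hv.2.1
    have n3 := h.ne hx.2.1
    exact ⟨fun hr => n1.2.2 (hCR c (hC a haC c (arc_of_link haT hc.2.1)) hr).symm,
      fun hr => n3.2.2 (hCR x (hC a haC x (arc_of_link haT hx.2.1)) hr)⟩
  · exact ⟨(hv.tri h hctr g hR).isTri, fun hr => absurd hr hR⟩

theorem Growth.not_cyclic (h : IsTailLink L) (hctr : IsCenter L ctr)
    (g : Growth L ctr R U p ρ) (h1 : CenteredRoots L ctr R U) (h2 : SeparatedRoots L ctr R)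
    {a v c x : V} (ha : a ∉ U)
    (hv : Uncovered L R U p a v c) (hc : Uncovered L R U p a c x)
    (hx : Uncovered L R U p a x v) : False := by
  have kv := hv.isTri_and_not_root h hctr g h1 h2 ha hc hx
  have kc := hc.isTri_and_not_root h hctr g h1 h2 ha hx hv
  have kx := hx.isTri_and_not_root h hctr g h1 h2 ha hv hc
  by_cases hcR : c ∈ R
  · exact g.not_cyclic_of_not_root h hctr h1 hc hx hv kc.1 (kc.2 hcR).1 (kc.2 hcR).2
  · by_cases hxR : x ∈ R
    · exact g.not_cyclic_of_not_root h hctr h1 hx hv hc kx.1 (kx.2 hxR).1 (kx.2 hxR).2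
    · exact g.not_cyclic_of_not_root h hctr h1 hv hc hx kv.1 hcR hxR

theorem Growth.insert_of_isTri (h : IsTailLink L) (hctr : IsCenter L ctr)
    (g : Growth L ctr R U p ρ) (h1 : CenteredRoots L ctr R U) (h2 : SeparatedRoots L ctr R)
    {a u z : V} (ha : a ∉ U) (hT : IsTri L a) (hu : u ∈ U) (huz : L a u z) :
    ∃ p' ρ', Growth L ctr R (insert a U) p' ρ' := by
  by_cases hs : ∃ u z, u ∈ U ∧ L a u z ∧ ∀ x y, Uncovered L R U p a x y → u = x ∨ u = y
  · obtain ⟨u, z, hu, huz, hs⟩ := hs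
    exact g.insert_leaf h ha hu (arc_of_link hT huz)
      fun x y hx hxy hyx hc => hs x y ⟨hx, hxy, hyx, hc⟩
  -- Each vertex of `U` linked to `a` now misses some uncovered triple. Tracking their tail-vertices
  -- leaves three patterns: one vertex repeated, a cyclic orientation, or two triples sharing a
  -- vertex outside of `U`.
  · push Not at hs
    obtain ⟨x, y, hxy, hux, huy⟩ := hs u z hu huz
    have htri : Tri L a x y u := by
      obtain ⟨w, hw⟩ := h.exists_tri_of_isTri hT hxy.2.1
      have := hw.mem h huz
      grind
    have key : ∀ v w v' w', Uncovered L R U p a v' w' → v ≠ v' → v ≠ w' → Tri L a v w u →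
        u ≠ v → u ≠ w → v ≠ w → (v' = w ∧ w' = u) ∨ (v' = u ∧ w' = w) := by
      intro v w v' w' hu' _ _ ht _ _ _
      have := ht.mem h hu'.2.1
      have := h.ne hu'.2.1
      grind
    have n := h.ne hxy.2.1
    have htri' := htri.swap h
    obtain ⟨x', y', hxy', h1', h2'⟩ := hs x y hxy.1 hxy.2.1
    rcases key x y x' y' hxy' h1' h2' htri hux huy n.2.2 with ⟨rfl, rfl⟩ | ⟨rfl, rfl⟩
    · obtain ⟨v, w, hvw, h3, h4⟩ := hs x' x hxy'.1 (h.symm hxy.2.1)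
      rcases key x' x v w hvw h3 h4 htri' huy hux n.2.2.symm with ⟨rfl, rfl⟩ | ⟨rfl, rfl⟩
      · exact g.insert_of_repeated h hctr h1 h2 ha hxy hvw hxy'
      · exact (g.not_cyclic h hctr h1 h2 ha hxy hxy' hvw).elim
    · by_cases c1 : Uncovered L R U p a x x'
      · exact g.insert_of_repeated h hctr h1 h2 ha c1 hxy hxy'
      by_cases c2 : Uncovered L R U p a x' x
      · exact g.insert_of_repeated h hctr h1 h2 ha c2 hxy' hxy
      have hy : y' ∉ U := by
        intro hy
        obtain ⟨v, w, hvw, h3, h4⟩ := hs y' x hy (h.symm hxy.2.1)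
        rcases key y' x v w hvw h3 h4 htri' huy hux n.2.2.symm with ⟨rfl, rfl⟩ | ⟨rfl, rfl⟩
        · exact c1 hvw
        · exact c2 hvw
      rcases h.other htri.2.2 with k | k
      · exact g.insert_of_two h hctr h1 ha ⟨h.symm htri.1, htri.2.2, htri.2.1⟩ hy hxy hxy' k c1
      · exact g.insert_of_two h hctr h1 ha ⟨htri.2.1, h.symm htri.2.2, h.symm htri.1⟩ hy hxy' hxy k c2

/-! ### Roots in minimal closed sets, and the spanning forest -/

/-- A nonempty set that is closed under the arcs. -/
def IsClosedSet (L : V → V → V → Prop) (ctr : V → V) (C : Set V) : Prop :=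
  C.Nonempty ∧ ∀ v ∈ C, ∀ w, Arc L ctr v w → w ∈ C

theorem eq_of_minimal_of_mem {C C' : Set V} (hC : Minimal (IsClosedSet L ctr) C)
    (hC' : Minimal (IsClosedSet L ctr) C') {v : V} (hv : v ∈ C) (hv' : v ∈ C') : C = C' := by
  have k : IsClosedSet L ctr (C ∩ C') := ⟨⟨v, hv, hv'⟩, fun v hv w hw =>
    ⟨hC.prop.2 v hv.1 w hw, hC'.prop.2 v hv.2 w hw⟩⟩
  exact Set.Subset.antisymm (fun x hx => (hC.le_of_le k Set.inter_subset_left hx).2)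
    (fun x hx => (hC'.le_of_le k Set.inter_subset_right hx).1)

/-- `R` consists of one vertex of each minimal closed set, with a triangle of links if possible. -/
def IsRootSet (L : V → V → V → Prop) (ctr : V → V) (R : Set V) : Prop :=
  ∃ rt : {C : Set V // Minimal (IsClosedSet L ctr) C} → V,
    (∀ C, rt C ∈ C.1 ∧ ((∃ v ∈ C.1, IsTri L v) → IsTri L (rt C))) ∧ R = Set.range rt

theorem exists_isRootSet (L : V → V → V → Prop) (ctr : V → V) : ∃ R, IsRootSet L ctr R := by
  have key : ∀ C : {C : Set V // Minimal (IsClosedSet L ctr) C},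
      ∃ r, r ∈ C.1 ∧ ((∃ v ∈ C.1, IsTri L v) → IsTri L r) := by
    intro C
    by_cases hT : ∃ v ∈ C.1, IsTri L v
    · obtain ⟨v, hv, hvT⟩ := hT
      exact ⟨v, hv, fun _ => hvT⟩
    · obtain ⟨v, hv⟩ := C.2.prop.1
      exact ⟨v, hv, fun k => absurd k hT⟩
  choose rt hrt using key
  exact ⟨_, rt, hrt, rfl⟩

theorem IsRootSet.exists_minimal (hR : IsRootSet L ctr R) {r : V} (hr : r ∈ R) :
    ∃ C, Minimal (IsClosedSet L ctr) C ∧ r ∈ C ∧ (∀ w ∈ C, w ∈ R → w = r) ∧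
      (¬ IsTri L r → ∀ v ∈ C, ¬ IsTri L v) := by
  obtain ⟨rt, h1, rfl⟩ := hR
  obtain ⟨C, rfl⟩ := hr
  refine ⟨C, C.2, (h1 C).1, ?_, fun hn v hv hT => hn ((h1 C).2 ⟨v, hv, hT⟩)⟩
  rintro w hw ⟨C', rfl⟩
  rw [Subtype.ext (eq_of_minimal_of_mem C.2 C'.2 hw (h1 C').1)]

theorem IsRootSet.inter_nonempty (hR : IsRootSet L ctr R) {C : Set V}
    (hC : Minimal (IsClosedSet L ctr) C) : ∃ r ∈ C, r ∈ R := by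
  obtain ⟨rt, h1, rfl⟩ := hR
  exact ⟨_, (h1 ⟨C, hC⟩).1, ⟨C, hC⟩, rfl⟩

theorem IsRootSet.separatedRoots (hR : IsRootSet L ctr R) : SeparatedRoots L ctr R := by
  intro r hr _
  obtain ⟨C, hC, hrC, h1, -⟩ := hR.exists_minimal hr
  exact ⟨C, hrC, hC.prop.2, h1⟩

theorem IsRootSet.centeredRoots (h : IsTailLink L) (hctr : IsCenter L ctr)
    (hR : IsRootSet L ctr R) (hU : ∀ C, Minimal (IsClosedSet L ctr) C →
      (∀ v ∈ C, ¬ IsTri L v) → C ⊆ U) : CenteredRoots L ctr R U := by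
  intro r x y hr hT hxy
  obtain ⟨C, hC, hrC, h1, h2⟩ := hR.exists_minimal hr
  have hc : ctr r ∈ C := hC.prop.2 r hrC _ (Or.inr ⟨hT, rfl⟩)
  refine ⟨hU C hC (h2 hT) hc, h2 hT _ hc, fun hcR => ?_⟩
  have := h1 _ hc hcR
  have := h.ne hxy
  have := hctr hT hxy
  grind

/-- Two roots cannot be the tail-vertices of one triple: they lie in disjoint closed sets, so
neither has an arc to the other, and both have the third vertex as center, which would lie in both
sets. -/
theorem IsRootSet.growth (h : IsTailLink L) (hctr : IsCenter L ctr) (hR : IsRootSet L ctr R) :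
    Growth L ctr R R id (fun _ => 0) where
  root_mem hr := hr
  root_rank _ := rfl
  map_mem hv hn := absurd hv hn
  rank_lt hv hn := absurd hv hn
  arc hv hn := absurd hv hn
  cover := by
    intro v x y hv hx hvx hxv
    exfalso
    obtain ⟨C, hC, hvC, h1, -⟩ := hR.exists_minimal hv
    obtain ⟨C', hC', hxC', h1', -⟩ := hR.exists_minimal hx
    have n := h.ne hvx
    have hxC : x ∉ C := fun k => n.1 (h1 x k hx).symm
    have hvC' : v ∉ C' := fun k => n.1 (h1' v k hv)
    have hTv : ¬ IsTri L v := fun hT => hxC (hC.prop.2 v hvC x (arc_of_link hT hvx))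
    have hTx : ¬ IsTri L x := fun hT => hvC' (hC'.prop.2 x hxC' v (arc_of_link hT hxv))
    have hcv := hC.prop.2 v hvC _ (Or.inr ⟨hTv, rfl⟩)
    have hcx := hC'.prop.2 x hxC' _ (Or.inr ⟨hTx, rfl⟩)
    have := hctr hTv hvx
    have := hctr hTx hxv
    have hyC : y ∈ C := by grind
    have hyC' : y ∈ C' := by grind
    exact hxC (eq_of_minimal_of_mem hC hC' hyC hyC' ▸ hxC')

theorem Growth.insert_of_not_isTri (h : IsTailLink L) (hctr : IsCenter L ctr)
    (g : Growth L ctr R U p ρ) {a w : V} (ha : a ∉ U) (hT : ¬ IsTri L a)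
    (hw : w ∈ U) (harc : Arc L ctr a w) : ∃ p' ρ', Growth L ctr R (insert a U) p' ρ' := by
  refine g.insert_leaf h ha hw harc fun x y _ hxy _ _ => ?_
  rcases harc with k | k
  · exact absurd k.1 hT
  · exact k.2 ▸ hctr hT hxy

theorem IsRootSet.exists_growth_univ [Finite V] (h : IsTailLink L) (hctr : IsCenter L ctr)
    (hR : IsRootSet L ctr R) : ∃ p ρ, Growth L ctr R Set.univ p ρ := by
  obtain ⟨U, ⟨p, ρ, g⟩, hmax⟩ := (Set.toFinite {U | ∃ p ρ, Growth L ctr R U p ρ}).exists_maximal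
    ⟨R, _, _, hR.growth h hctr⟩
  have hins : ∀ a, a ∉ U → ¬ ∃ p' ρ', Growth L ctr R (insert a U) p' ρ' := fun a ha k =>
    ha (hmax k (Set.subset_insert a U) (Set.mem_insert a U))
  suffices hU : U = Set.univ from hU ▸ ⟨p, ρ, g⟩
  by_contra hne
  -- Vertices with centers are added without any condition on roots, so minimal sets without
  -- triangles are already in `U`; this supplies `CenteredRoots` for the triangle case.
  have hstar : ∀ C, Minimal (IsClosedSet L ctr) C → (∀ v ∈ C, ¬ IsTri L v) → C ⊆ U := by
    intro C hC hT
    by_contra hCU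
    obtain ⟨b, hbC, hbU⟩ := Set.not_subset.1 hCU
    obtain ⟨r, hrC, hrR⟩ := hR.inter_nonempty hC
    have hn : ¬ IsClosedSet L ctr (C \ U) := fun k =>
      (hC.le_of_le k Set.sdiff_subset hrC).2 (g.root_mem hrR)
    apply hn
    refine ⟨⟨b, hbC, hbU⟩, fun a ha w hw => ⟨hC.prop.2 a ha.1 w hw, fun hwU => ?_⟩⟩
    exact hins a ha.2 (g.insert_of_not_isTri h hctr ha.2 (hT a ha.1) hwU hw)
  have hn : IsClosedSet L ctr Uᶜ := by
    refine ⟨Set.nonempty_compl.2 hne, fun a ha w hw hwU => hins a ha ?_⟩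
    by_cases hT : IsTri L a
    · rcases hw with ⟨-, z, hz⟩ | hw
      · exact g.insert_of_isTri h hctr (hR.centeredRoots h hctr hstar) hR.separatedRoots ha hT
          hwU hz
      · exact absurd hT hw.1
    · exact g.insert_of_not_isTri h hctr ha hT hwU hw
  obtain ⟨C, hCU, hC⟩ := exists_minimal_le_of_wellFoundedLT (IsClosedSet L ctr) _ hn
  obtain ⟨r, hrC, hrR⟩ := hR.inter_nonempty hC
  exact hCU hrC (g.root_mem hrR)

/-! ### Coloring the forest -/

/-- A forest has a proper two-coloring. -/
theorem exists_coloring_of_rank {V : Type*} {R : Set V} {p : V → V} {ρ : V → ℕ}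
    (hρ : ∀ v ∉ R, ρ (p v) < ρ v) : ∃ c : V → Fin 2, ∀ v ∉ R, c v ≠ c (p v) := by
  let c : V → Fin 2 := (measure ρ).wf.fix (C := fun _ => Fin 2) fun v ih =>
    open Classical in if hv : v ∈ R then 0 else ih (p v) (hρ v hv) + 1
  refine ⟨c, fun v hv => ?_⟩
  have : c v = c (p v) + 1 := by
    simp only [c]
    rw [WellFounded.fix_eq, dif_neg hv]
  rw [this]
  generalize c (p v) = k
  revert k
  decide

theorem exists_coloring [Finite V] (h : IsTailLink L) :
    ∃ c : V → Fin 2, ∀ v x y, L v x y → ¬ (c v = c x ∧ c v = c y) := by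
  obtain ⟨ctr, hctr⟩ := h.exists_center
  obtain ⟨R, hR⟩ := exists_isRootSet L ctr
  obtain ⟨p, ρ, g⟩ := hR.exists_growth_univ h hctr
  obtain ⟨c, hc⟩ := exists_coloring_of_rank fun v hv => g.rank_lt (Set.mem_univ v) hv
  have key : ∀ v x y, L v x y → L x v y → ¬ (c v = c x ∧ c v = c y) := by
    intro v x y h1 h2
    have := g.cover (Set.mem_univ v) (Set.mem_univ x) h1 h2
    have := hc v
    have := hc x
    grind
  refine ⟨c, fun v x y hv => ?_⟩
  rcases h.other hv with k | k
  · exact key v x y hv k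
  · exact fun e => key v y x (h.symm hv) k e.symm

end IsTailLink

/-! ### Directed hypergraphs -/

namespace DirectedHypergraph

theorem mem_verts {V : Type*} {e : DirectedHyperedge V} {v : V} :
    v ∈ e.verts ↔ v ∈ e.tail ∨ v ∈ e.head :=
  Finset.mem_disjUnion

theorem card_verts {V : Type*} (e : DirectedHyperedge V) :
    e.verts.card = e.tail.card + e.head.card :=
  Finset.card_disjUnion _ _ _

theorem notMem_head {V : Type*} {e : DirectedHyperedge V} {v : V} (hv : v ∈ e.tail) :
    v ∉ e.head :=
  Finset.disjoint_left.1 e.disjoint_tail_head hv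

theorem PropertyS.properlyTwoColorable {V : Type*} [Finite V] [DecidableEq V]
    {H : DirectedHypergraph V} (h3 : H.IsUniform 3) (hS : H.PropertyS) :
    H.ProperlyTwoColorable := by
  -- The two tail-vertices are chosen per vertex set, not per hyperedge, since one set may carry
  -- several splittings.
  have key : ∀ F : Finset V, ∃ T : Finset V, (∃ e ∈ H.edges, e.verts = F) →
      ∃ e ∈ H.edges, e.verts = F ∧ T ⊆ e.tail ∧ T.card = 2 := by
    intro F
    by_cases hF : ∃ e ∈ H.edges, e.verts = F
    · obtain ⟨e, he, rfl⟩ := hF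
      have h1 := h3 e he
      have h2 := hS.1 e he
      rw [card_verts] at h1
      obtain ⟨T, hT, hc⟩ := Finset.exists_subset_card_eq (show 2 ≤ e.tail.card by omega)
      exact ⟨T, fun _ => ⟨e, he, rfl, hT, hc⟩⟩
    · exact ⟨∅, fun k => absurd k hF⟩
  choose T hT using key
  have hL : IsTailLink fun v x y : V => (∃ e ∈ H.edges, e.verts = {v, x, y}) ∧
      v ∈ T {v, x, y} ∧ v ≠ x ∧ v ≠ y ∧ x ≠ y := by
    have hsub : ∀ F, (∃ e ∈ H.edges, e.verts = F) → T F ⊆ F ∧ (T F).card = 2 := by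
      intro F hF
      obtain ⟨e, -, h1, h2, h3⟩ := hT F hF
      exact ⟨fun x hx => h1 ▸ mem_verts.2 (Or.inl (h2 hx)), h3⟩
    constructor
    · rintro v x y ⟨h1, h2, h3, h4, h5⟩
      rw [Finset.pair_comm x y] at h1 h2
      exact ⟨h1, h2, h4, h3, h5.symm⟩
    · exact fun k => k.2.2
    · rintro v x y ⟨h1, h2, h3, h4, h5⟩
      obtain ⟨k1, k2⟩ := hsub _ h1
      obtain ⟨w, hw, hwv⟩ := Finset.exists_mem_ne (show 1 < (T {v, x, y}).card by omega) v
      have hm := k1 hw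
      simp only [Finset.mem_insert, Finset.mem_singleton] at hm
      rcases hm with rfl | rfl | rfl
      · exact absurd rfl hwv
      · left
        rw [Finset.insert_comm w v]
        exact ⟨h1, hw, h3.symm, h5, h4⟩
      · right
        rw [Finset.insert_comm w v, Finset.pair_comm w x]
        exact ⟨h1, hw, h4.symm, h5.symm, h3⟩
    · rintro v x y ⟨h1, h2, h3, h4, h5⟩ ⟨-, h6, -⟩ ⟨-, h7, -⟩
      rw [Finset.insert_comm x v] at h6
      rw [Finset.insert_comm y v, Finset.pair_comm y x] at h7
      have hs : ({v, x, y} : Finset V) ⊆ T {v, x, y} := by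
        intro w hw
        simp only [Finset.mem_insert, Finset.mem_singleton] at hw
        rcases hw with rfl | rfl | rfl
        exacts [h2, h6, h7]
      have hc := Finset.card_le_card hs
      rw [(hsub _ h1).2, Finset.card_eq_three.2 ⟨v, x, y, h3, h4, h5, rfl⟩] at hc
      omega
    · rintro v x y z w ⟨h1, h2, h3, h4, h5⟩ ⟨h1', h2', h3', h4', h5'⟩
      by_contra hc
      push Not at hc
      obtain ⟨e, he, k1, k2, -⟩ := hT _ h1
      obtain ⟨e', he', k1', k2', -⟩ := hT _ h1'
      have hinter : e.verts ∩ e'.verts = {v} := by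
        ext u
        rw [k1, k1']
        simp only [Finset.mem_inter, Finset.mem_insert, Finset.mem_singleton]
        grind
      have hne : e ≠ e' := by
        rintro rfl
        have : x ∈ e.verts ∩ e.verts := by simp [k1]
        rw [hinter, Finset.mem_singleton] at this
        exact h3 this.symm
      rcases hS.2 e he e' he' hne v hinter with k | k
      · exact notMem_head (k2 h2) k
      · exact notMem_head (k2' h2') k
  obtain ⟨c, hc⟩ := hL.exists_coloring
  refine ⟨c, fun e he => ?_⟩
  obtain ⟨e', -, k1, k2, k3⟩ := hT e.verts ⟨e, he, rfl⟩
  obtain ⟨v, hv⟩ := Finset.card_pos.1 (show 0 < (T e.verts).card by omega)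
  have hve : v ∈ e.verts := k1 ▸ mem_verts.2 (Or.inl (k2 hv))
  have hcard : (e.verts.erase v).card = 2 := by
    rw [Finset.card_erase_of_mem hve, h3 e he]
  obtain ⟨x, y, hxy, hex⟩ := Finset.card_eq_two.1 hcard
  have heq : e.verts = {v, x, y} := by rw [← hex, Finset.insert_erase hve]
  have hx : x ∈ e.verts.erase v := by simp [hex]
  have hy : y ∈ e.verts.erase v := by simp [hex]
  rw [Finset.mem_erase] at hx hy
  have := hc v x y ⟨⟨e, he, heq⟩, heq ▸ hv, hx.1.symm, hy.1.symm, hxy⟩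
  by_cases hvx : c v = c x
  · exact ⟨v, hve, y, hy.2, fun k => this ⟨hvx, k⟩⟩
  · exact ⟨v, hve, x, hx.2, hvx⟩

theorem IsTwoToOne.isUniform {V : Type*} {H : DirectedHypergraph V} (h : H.IsTwoToOne) :
    H.IsUniform 3 := by
  intro e he
  rw [card_verts, (h e he).1, (h e he).2]

theorem PropertyS.avoids {V : Type*} [DecidableEq V] {H : DirectedHypergraph V}
    (hS : H.PropertyS) : H.Avoids forbiddenPair := by
  rintro ⟨f, hf⟩
  have h1 := hf _ (Or.inl rfl)
  have h2 := hf _ (Or.inr rfl)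
  have hinj : ∀ i j, f i = f j ↔ i = j := fun i j => f.injective.eq_iff
  have hk := hS.2 _ h1 _ h2 (fun k => by
    have := congrArg (fun e => f 2 ∈ e.head) k
    simp [DirectedHyperedge.map, hinj] at this) (f 0) (by
    ext u
    simp only [Finset.mem_inter, mem_verts, DirectedHyperedge.map, Finset.map_insert,
      Finset.map_singleton, Finset.mem_insert, Finset.mem_singleton]
    constructor
    · rintro ⟨(rfl | rfl) | rfl, k⟩ <;> simp [hinj] at k ⊢
    · rintro rfl
      simp)
  simp [DirectedHyperedge.map, hinj] at hk

theorem IsTwoToOne.propertyS {V : Type*} [DecidableEq V] {H : DirectedHypergraph V}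
    (h : H.IsTwoToOne) (hA : H.Avoids forbiddenPair) : H.PropertyS := by
  have key : ∀ e ∈ H.edges, ∀ v ∈ e.verts, v ∉ e.head →
      ∃ b c, v ≠ b ∧ v ≠ c ∧ b ≠ c ∧ e.tail = {v, b} ∧ e.head = {c} := by
    intro e he v hv hvh
    have hvt := (mem_verts.1 hv).resolve_right hvh
    obtain ⟨c, hc⟩ := Finset.card_eq_one.1 (h e he).2
    have hcard : (e.tail.erase v).card = 1 := by
      rw [Finset.card_erase_of_mem hvt, (h e he).1]
    obtain ⟨b, hb⟩ := Finset.card_eq_one.1 hcard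
    have hbm : b ∈ e.tail.erase v := by simp [hb]
    rw [Finset.mem_erase] at hbm
    refine ⟨b, c, hbm.1.symm, ?_, ?_, by rw [← hb, Finset.insert_erase hvt], hc⟩
    · rintro rfl
      simp [hc] at hvh
    · rintro rfl
      exact notMem_head hbm.2 (by simp [hc])
  refine ⟨fun e he => by rw [(h e he).1, (h e he).2]; norm_num, fun e he e' he' _ v hv => ?_⟩
  by_contra hn
  push Not at hn
  have hvm : v ∈ e.verts ∩ e'.verts := by simp [hv]
  rw [Finset.mem_inter] at hvm
  obtain ⟨b, c, h1, h2, h3, ht, hh⟩ := key e he v hvm.1 hn.1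
  obtain ⟨b', c', h1', h2', h3', ht', hh'⟩ := key e' he' v hvm.2 hn.2
  have hd : ∀ u, (u = b ∨ u = c) → (u = b' ∨ u = c') → u = v := by
    intro u hu hu'
    rw [← Finset.mem_singleton, ← hv, Finset.mem_inter, mem_verts, mem_verts, ht, hh, ht', hh']
    simp only [Finset.mem_insert, Finset.mem_singleton]
    tauto
  have d1 := hd b
  have d2 := hd c
  -- Two hyperedges meeting only in a common tail-vertex span five distinct vertices, which is a
  -- copy of the forbidden pair.
  have hinj : Function.Injective ![v, b, c, b', c'] := by
    intro i j hij
    fin_cases i <;> fin_cases j <;> simp at hij ⊢ <;> grind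
  refine hA ⟨⟨_, hinj⟩, ?_⟩
  rintro _ (rfl | rfl)
  · convert he using 1
    ext u <;> simp [DirectedHyperedge.map, ht, hh]
  · convert he' using 1
    ext u <;> simp [DirectedHyperedge.map, ht', hh']

end DirectedHypergraph

theorem mainTheorem1 {V : Type*} [Fintype V] [DecidableEq V] :
    (∀ H : DirectedHypergraph V, H.IsTwoToOne → H.PropertyS → H.ProperlyTwoColorable) ∧
    (∀ H : DirectedHypergraph V, H.IsTwoToOne →
      (H.PropertyS ↔ H.Avoids DirectedHypergraph.forbiddenPair)) ∧
    (∀ H : DirectedHypergraph V, H.IsUniform 3 → H.PropertyS → H.ProperlyTwoColorable) :=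
  ⟨fun _ h hS => hS.properlyTwoColorable h.isUniform,
    fun _ h => ⟨fun hS => hS.avoids, h.propertyS⟩,
    fun _ h hS => hS.properlyTwoColorable h⟩
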